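/- Let $V=\bigoplus_{n=0}^{\infty}V_{(n)}$ be an $\mathbb{N}$-graded vertex algebra over $\mathbb{C}$, that is, a vertex algebra with vacuum vector $\mathbf{1}$ and products $u_nv$ ($n\in\mathbb{Z}$) such that $\mathbf{1}\in V_{(0)}$ and $u_nv\in V_{(p+q-n-1)}$ for $u\in V_{(p)}$, $v\in V_{(q)}$ (where $V_{(k)}=0$ for $k<0$). Let $D:V\to V$ be the linear map $Dv=v_{-2}\mathbf{1}$. The bracket $[u,v]=u_0v$ makes $V_{(1)}$ a left Leibniz algebra, i.e. $[a,[b,c]]=[[a,b],c]+[b,[a,c]]$. A left Leibniz algebra $L$ is called cyclic if there is $u\in L$ with $L=\mathrm{Span}\{u^k : k\geq 1\}$, where $u^1=u$ and $u^{k+1}=[u,u^k]$. Assume that (a) $2\leq\dim V_{(0)}<\infty$ and $V$ is generated, as a vertex algebra, by $V_{(0)}$ and $V_{(1)}$; (b) $V_{(1)}$ is a cyclic left Leibniz algebra and $\dim V_{(1)}$ is $2$ or $3$; (c) $\{v\in V_{(0)} : Dv=0\}=\mathbb{C}\mathbf{1}$. Then $V$ is indecomposable, i.e. $V\neq 0$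 and $V$ is not the direct sum of two nonzero ideals, and $V$ is not simple, i.e. $V$ has an ideal different from $0$ and $V$. -/

import Mathlib

open scoped VertexOperator

/-- A vertex algebra over `ℂ`: a vacuum vector and a linear state-field correspondence `Y`
(so `Y u x v` is a Laurent series in `x` with coefficients `uₙ v = (Y u)[[n]] v`), subject to the
vacuum and creation properties and the Jacobi identity, the latter written in components
(Borcherds' identity). All sums involved have only finitely many nonzero terms. -/
class VertexAlgebra (V : Type*) [AddCommGroup V] [Module ℂ V] where
  /-- the state-field correspondence -/
  Y : V →ₗ[ℂ] VertexOperator ℂ V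
  /-- the vacuum vector -/
  vac : V
  vac_ncoeff : ∀ (n : ℤ) (v : V), ((Y vac)[[n]]) v = if n = -1 then v else 0
  ncoeff_neg_one_vac : ∀ u : V, ((Y u)[[-1]]) vac = u
  ncoeff_vac : ∀ (u : V) (n : ℤ), 0 ≤ n → ((Y u)[[n]]) vac = 0
  borcherds : ∀ (u v w : V) (p q r : ℤ),
    ∑ᶠ i : ℕ, Ring.choose p i • ((Y (((Y u)[[r + i]]) v))[[p + q - i]]) w =
      ∑ᶠ i : ℕ, ((-1 : ℤ) ^ i * Ring.choose r i) •
        (((Y u)[[p + r - i]]) (((Y v)[[q + i]]) w)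
          - (r.negOnePow : ℤ) • ((Y v)[[q + r - i]]) (((Y u)[[p + i]]) w))

/-- A left Leibniz algebra structure over `ℂ`. -/
structure LeftLeibnizStructure (L : Type*) [AddCommGroup L] [Module ℂ L] where
  /-- the bracket -/
  bracket : L →ₗ[ℂ] L →ₗ[ℂ] L
  leibniz : ∀ a b c : L,
    bracket a (bracket b c) = bracket (bracket a b) c + bracket b (bracket a c)

namespace LeftLeibnizStructure

variable {L : Type*} [AddCommGroup L] [Module ℂ L]

/-- The left-normed powers with the exponent shifted by one: `pow u k` is `u ^ (k + 1)`, where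
`u ^ 1 = u` and `u ^ (n + 1) = [u, u ^ n]`. -/
def pow (S : LeftLeibnizStructure L) (u : L) : ℕ → L
  | 0 => u
  | k + 1 => S.bracket u (S.pow u k)

/-- A Leibniz algebra is cyclic if it is spanned by the powers of a single element. -/
def IsCyclic (S : LeftLeibnizStructure L) : Prop :=
  ∃ u : L, Submodule.span ℂ (Set.range (S.pow u)) = ⊤

end LeftLeibnizStructure

namespace VertexAlgebra

section

variable {V : Type*} [AddCommGroup V] [Module ℂ V] [VertexAlgebra V]

/-- The `n`-th product `uₙ v`, linear in both arguments. -/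
noncomputable def nprod (n : ℤ) : V →ₗ[ℂ] V →ₗ[ℂ] V :=
  (LinearMap.proj n ∘ₗ VertexOperator.ncoeff) ∘ₗ Y

theorem nprod_apply (n : ℤ) (u v : V) : nprod n u v = ((Y u)[[n]]) v := rfl

/-- The canonical derivation `D v = v₋₂ 𝟏`. -/
noncomputable def D : V →ₗ[ℂ] V := (nprod (-2)).flip vac

theorem nprod_zero_leibniz (u v w : V) :
    nprod 0 u (nprod 0 v w) = nprod 0 (nprod 0 u v) w + nprod 0 v (nprod 0 u w) := by
  have h := borcherds u v w 0 0 0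
  rw [finsum_eq_single _ 0, finsum_eq_single _ 0] at h
  · simp at h
    simp only [nprod_apply, h]
    abel
  · intro i hi
    simp [Ring.choose_zero_pos ℤ (Nat.pos_of_ne_zero hi)]
  · intro i hi
    simp [Ring.choose_zero_pos ℤ (Nat.pos_of_ne_zero hi)]

/-- A vertex subalgebra: a subspace containing the vacuum and closed under all products. -/
def IsSubalgebra (U : Submodule ℂ V) : Prop :=
  vac ∈ U ∧ ∀ u ∈ U, ∀ v ∈ U, ∀ n : ℤ, nprod n u v ∈ U

/-- An ideal (two-sided) of a vertex algebra. -/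
def IsIdeal (I : Submodule ℂ V) : Prop :=
  ∀ v : V, ∀ w ∈ I, ∀ n : ℤ, nprod n v w ∈ I ∧ nprod n w v ∈ I

/-- The set `S` generates `V`: no proper vertex subalgebra contains `S`. -/
def IsGeneratedBy (S : Set V) : Prop :=
  ∀ U : Submodule ℂ V, IsSubalgebra U → S ⊆ U → U = ⊤

variable (V) in
/-- A vertex algebra is simple if it is nonzero and its only ideals are `0` and itself. -/
def IsSimple : Prop :=
  Nontrivial V ∧ ∀ I : Submodule ℂ V, IsIdeal I → I = ⊥ ∨ I = ⊤

variable (V) in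
/-- A vertex algebra is indecomposable if it is nonzero and is not the direct sum of two
nonzero ideals. -/
def IsIndecomposable : Prop :=
  Nontrivial V ∧ ∀ I J : Submodule ℂ V, IsIdeal I → IsIdeal J → IsCompl I J → I = ⊥ ∨ J = ⊥

/-- The family `𝒱` makes `V` an `ℕ`-graded vertex algebra: `V = ⨁ 𝒱 n`, the vacuum has degree
`0`, and `uₙ v` has degree `p + q - n - 1` for `u`, `v` of degrees `p`, `q` (hence vanishes if
this number is negative). -/
structure IsNGrading (𝒱 : ℕ → Submodule ℂ V) : Prop where
  isInternal : DirectSum.IsInternal 𝒱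
  vac_mem : vac ∈ 𝒱 0
  nprod_mem : ∀ (p q k : ℕ) (n : ℤ), (k : ℤ) = p + q - n - 1 →
    ∀ u ∈ 𝒱 p, ∀ v ∈ 𝒱 q, nprod n u v ∈ 𝒱 k
  nprod_eq_zero : ∀ (p q : ℕ) (n : ℤ), (p : ℤ) + q - n - 1 < 0 →
    ∀ u ∈ 𝒱 p, ∀ v ∈ 𝒱 q, nprod n u v = 0

/-- The left Leibniz algebra structure `[u, v] = u₀ v` on the degree one subspace. -/
noncomputable def IsNGrading.leibnizOne {𝒱 : ℕ → Submodule ℂ V} (h : IsNGrading 𝒱) :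
    LeftLeibnizStructure (𝒱 1) where
  bracket := LinearMap.mk₂ ℂ
    (fun u v => ⟨nprod 0 u.1 v.1, h.nprod_mem 1 1 1 0 (by norm_num) _ u.2 _ v.2⟩)
    (fun _ _ _ => Subtype.ext (by simp))
    (fun _ _ _ => Subtype.ext (by simp))
    (fun _ _ _ => Subtype.ext (by simp))
    (fun _ _ _ => Subtype.ext (by simp))
  leibniz a b c := Subtype.ext (by simpa using nprod_zero_leibniz a.1 b.1 c.1)

end

end VertexAlgebra

/-! Indecomposability: if `V = I ⊕ J` and `vac = e + f` accordingly, then `e` is idempotent for the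
`-1` product and `D e = 0`. The kernel condition makes the degree zero part of `e` a scalar multiple
of `vac`, and an idempotent of positive degree vanishes, so `e` is `0` or `vac`
(`idempotent_eq_zero_or_vac`).

Non-simplicity: `𝒱 0` is a commutative associative algebra under the `-1` product, and each `u` in
`𝒱 1` acts on it by the derivation `nprod 0 u`. A finite-dimensional algebra of dimension at least
two has a proper nonzero ideal `m` stable under derivations: one generated by a nontrivial
idempotent, or else the nilradical. Closing `m` under `D` and the modes of `𝒱 0` and `𝒱 1` that do
not lower degree already gives an ideal of `V`. Its degree zero part is still `m`, so it misses
`vac`. -/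

/-! ### Derivation-stable ideals of finite-dimensional algebras -/

section Derivations

variable {A : Type*} [CommRing A] [Algebra ℂ A]

/-- A derivation kills every idempotent. -/
theorem Derivation.apply_isIdempotentElem (δ : Derivation ℂ A A) {e : A} (he : e * e = e) :
    δ e = 0 := by
  have h : δ e = e * δ e + e * δ e := by
    conv_lhs => rw [← he, δ.leibniz]
    simp
  have h1 : e * δ e = 0 := by
    have := congrArg (e * ·) h
    simp only [mul_add, ← mul_assoc, he] at this
    simpa using this
  rw [h, h1, add_zero]

/-- In a finite-dimensional algebra, some positive power of every element is fixed by an idempotent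
multiple of that power. -/
theorem exists_pow_mul_isIdempotentElem [Module.Finite ℂ A] (a : A) :
    ∃ (n : ℕ) (b : A), n ≠ 0 ∧ (a ^ n * b) * (a ^ n * b) = a ^ n * b ∧
      a ^ n * (a ^ n * b) = a ^ n := by
  have : IsArtinianRing A := IsArtinianRing.of_finite ℂ A
  obtain ⟨n, c, hc⟩ := IsArtinian.exists_pow_succ_smul_dvd (R := A) (M := A) a 1
  simp only [smul_eq_mul, mul_one, Nat.succ_eq_add_one] at hc
  have key : ∀ k : ℕ, a ^ (n + 1 + k) * c ^ k = a ^ (n + 1) := by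
    intro k
    induction k with
    | zero => simp
    | succ k ih =>
      calc a ^ (n + 1 + (k + 1)) * c ^ (k + 1) = a ^ (k + 1) * c ^ k * (a ^ (n + 1) * c) := by ring
        _ = a ^ (n + 1 + k) * c ^ k := by rw [hc]; ring
        _ = a ^ (n + 1) := ih
  have h : a ^ (n + 1) * (a ^ (n + 1) * c ^ (n + 1)) = a ^ (n + 1) := by
    rw [← mul_assoc, ← pow_add, key]
  -- The exponent is `n + 1`, not `n`, so that it is positive even if the chain of powers stabilises
  -- at once.
  refine ⟨n + 1, c ^ (n + 1), n.succ_ne_zero, ?_, h⟩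
  rw [mul_right_comm, h]

/-- A finite-dimensional algebra of dimension at least two has a proper nonzero ideal that is stable
under all derivations. -/
theorem exists_ideal_stable_derivation [Module.Finite ℂ A] (hA : 2 ≤ Module.finrank ℂ A) :
    ∃ I : Ideal A, I ≠ ⊥ ∧ I ≠ ⊤ ∧ ∀ (δ : Derivation ℂ A A), ∀ a ∈ I, δ a ∈ I := by
  have : Nontrivial A := Module.nontrivial_of_finrank_pos (R := ℂ) (by omega)
  by_cases hid : ∃ e : A, e * e = e ∧ e ≠ 0 ∧ e ≠ 1
  · obtain ⟨e, he, he0, he1⟩ := hid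
    refine ⟨Ideal.span {e}, by simpa using he0, ?_, ?_⟩
    · rw [Ne, Ideal.span_singleton_eq_top]
      intro hu
      exact he1 (hu.mul_left_cancel (by rw [he, mul_one]))
    · intro δ a ha
      obtain ⟨b, rfl⟩ := Ideal.mem_span_singleton'.1 ha
      rw [δ.leibniz, δ.apply_isIdempotentElem he, smul_zero, zero_add]
      exact Ideal.mul_mem_right _ _ (Ideal.mem_span_singleton_self e)
  push Not at hid
  -- With only trivial idempotents `A` is local, and its nilradical is the set of nonunits.
  have hnil : ∀ a : A, ¬ IsUnit a → IsNilpotent a := by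
    intro a ha
    obtain ⟨n, b, hn, h1, h2⟩ := exists_pow_mul_isIdempotentElem a
    by_cases h0 : a ^ n * b = 0
    · exact ⟨n, by rw [← h2, h0, mul_zero]⟩
    · exact absurd ((isUnit_pow_iff hn).1 (IsUnit.of_mul_eq_one _ (hid _ h1 h0))) ha
  refine ⟨nilradical A, ?_, ?_, ?_⟩
  · intro hbot
    -- Subtracting an eigenvalue of multiplication by `a` leaves a nonunit, hence zero in a reduced
    -- `A`. So `A` would be one-dimensional.
    have hscal : ∀ a : A, ∃ c : ℂ, a = c • (1 : A) := by
      intro a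
      obtain ⟨c, hc⟩ := Module.End.exists_eigenvalue (LinearMap.mulLeft ℂ a)
      obtain ⟨v, hv⟩ := hc.exists_hasEigenvector
      refine ⟨c, ?_⟩
      have hm : a - c • 1 ∈ nilradical A := by
        apply hnil
        intro hu
        apply hv.2
        apply hu.mul_left_cancel
        have := hv.apply_eq_smul
        simp only [LinearMap.mulLeft_apply] at this
        simp [sub_mul, this]
      rw [hbot, Ideal.mem_bot] at hm
      exact sub_eq_zero.1 hm
    have := finrank_le_one (1 : A) (fun w => (hscal w).imp fun _ h => h.symm)
    omega
  · rw [Ne, Ideal.eq_top_iff_one, mem_nilradical]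
    exact fun h => not_isNilpotent_one h
  · intro δ a ha
    rw [mem_nilradical] at ha ⊢
    apply hnil
    intro hu
    by_cases h0 : a = 0
    · simp [h0] at hu
    -- Differentiating `a ^ (k + 1) = 0` gives `(k + 1) a ^ k δ a = 0`. In characteristic zero a
    -- unit `δ a` would force `a ^ k = 0`.
    obtain ⟨k, hk, hk'⟩ : ∃ k, a ^ (k + 1) = 0 ∧ a ^ k ≠ 0 := by
      classical
      have hpos : Nat.find ha ≠ 0 := by
        intro h
        have := Nat.find_spec ha
        rw [h] at this
        simp at this
      obtain ⟨k, hk⟩ := Nat.exists_eq_succ_of_ne_zero hpos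
      exact ⟨k, by rw [← Nat.succ_eq_add_one, ← hk]; exact Nat.find_spec ha,
        Nat.find_min ha (by omega)⟩
    have h := δ.leibniz_pow a (k + 1)
    rw [hk, map_zero, Nat.add_sub_cancel, smul_eq_mul, ← Nat.cast_smul_eq_nsmul ℂ] at h
    have h' := (smul_eq_zero.1 h.symm).resolve_left (by exact_mod_cast k.succ_ne_zero)
    exact hk' (hu.mul_right_cancel (by rw [h', zero_mul]))

end Derivations

theorem finsum_mem_of_forall_mem {M ι : Type*} [AddCommGroup M] [Module ℂ M] (W : Submodule ℂ M)
    {f : ι → M} (hf : ∀ i, f i ∈ W) : ∑ᶠ i, f i ∈ W :=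
  finsum_induction (· ∈ W) W.zero_mem (fun _ _ => W.add_mem) hf

theorem Submodule.biSup_ge_mono {M : Type*} [AddCommGroup M] [Module ℂ M] (𝒱 : ℕ → Submodule ℂ M)
    {a b : ℕ} (hab : a ≤ b) : ⨆ k ≥ b, 𝒱 k ≤ ⨆ k ≥ a, 𝒱 k :=
  biSup_mono fun _ hk => hab.trans hk

theorem Submodule.mem_biSup_ge {M : Type*} [AddCommGroup M] [Module ℂ M] {𝒱 : ℕ → Submodule ℂ M}
    {a k : ℕ} (hk : a ≤ k) {u : M} (hu : u ∈ 𝒱 k) : u ∈ ⨆ k ≥ a, 𝒱 k :=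
  mem_iSup_of_mem k (mem_iSup_of_mem hk hu)

/-! ### The derivation `D` and a criterion for ideals -/

namespace VertexAlgebra

variable {V : Type*} [AddCommGroup V] [Module ℂ V] [VertexAlgebra V]

theorem nprod_vac_left (n : ℤ) (v : V) : nprod n vac v = if n = -1 then v else 0 :=
  vac_ncoeff n v

theorem nprod_neg_one_vac (u : V) : nprod (-1) u vac = u :=
  ncoeff_neg_one_vac u

theorem nprod_vac_of_nonneg (u : V) {n : ℤ} (hn : 0 ≤ n) : nprod n u vac = 0 :=
  ncoeff_vac u n hn

theorem D_apply (v : V) : D v = nprod (-2) v vac := rfl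

theorem D_vac : D (vac : V) = 0 := by
  simp [D_apply, nprod_vac_left]

/-- The commutator formula. -/
theorem nprod_commutator (u v w : V) (p q : ℤ) :
    nprod p u (nprod q v w) - nprod q v (nprod p u w) =
      ∑ᶠ i : ℕ, Ring.choose p i • nprod (p + q - i) (nprod i u v) w := by
  have h := borcherds u v w p q 0
  rw [finsum_eq_single (fun i : ℕ => ((-1 : ℤ) ^ i * Ring.choose (0 : ℤ) i) • _) 0] at h
  · simpa [nprod_apply] using h.symm
  · intro i hi
    simp [Ring.choose_zero_pos ℤ (Nat.pos_of_ne_zero hi)]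

/-- The associator formula for iterated products. -/
theorem nprod_iterate (u v w : V) (q r : ℤ) :
    nprod q (nprod r u v) w = ∑ᶠ i : ℕ, ((-1 : ℤ) ^ i * Ring.choose r i) •
      (nprod (r - i) u (nprod (q + i) v w)
        - (r.negOnePow : ℤ) • nprod (q + r - i) v (nprod i u w)) := by
  have h := borcherds u v w 0 q r
  rw [finsum_eq_single (fun i : ℕ => Ring.choose (0 : ℤ) i • _) 0] at h
  · simpa [nprod_apply] using h
  · intro i hi
    simp [Ring.choose_zero_pos ℤ (Nat.pos_of_ne_zero hi)]

/-- In the iterate formula for the `-2` product of `nprod n u v` with `vac`, creation kills every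
term except `i = 0, 1`. -/
theorem D_nprod (n : ℤ) (u v : V) : D (nprod n u v) = nprod n u (D v) - n • nprod (n - 1) u v := by
  rw [D_apply, nprod_iterate, finsum_eq_sum_of_support_subset (s := Finset.range 2)]
  · rw [Finset.sum_range_succ, Finset.sum_range_one]
    simp only [Nat.cast_zero, Nat.cast_one, nprod_vac_of_nonneg u le_rfl,
      nprod_vac_of_nonneg u zero_le_one]
    norm_num [nprod_neg_one_vac, D_apply, sub_eq_add_neg]
  · intro i hi
    contrapose! hi
    simp only [Finset.coe_range, Set.mem_Iio, not_lt] at hi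
    rw [Function.notMem_support, nprod_vac_of_nonneg u (Int.natCast_nonneg i),
      nprod_vac_of_nonneg v (by omega)]
    simp

/-- A `D`-stable subspace contains all products `wₙ 𝟏` of its elements `w`. -/
theorem nprod_vac_mem {W : Submodule ℂ V} (hD : ∀ w ∈ W, D w ∈ W) {w : V} (hw : w ∈ W) (n : ℤ) :
    nprod n w vac ∈ W := by
  rcases le_or_gt 0 n with hn | hn
  · rw [nprod_vac_of_nonneg w hn]
    exact W.zero_mem
  obtain ⟨k, rfl⟩ : ∃ k : ℕ, n = -1 - k := ⟨(-1 - n).toNat, by omega⟩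
  clear hn
  induction k with
  | zero => simpa [nprod_neg_one_vac] using hw
  | succ k ih =>
    have h := D_nprod (-1 - k) w vac
    -- Applying `D` to `wₙ 𝟏` gives `-n` times `wₙ₋₁ 𝟏`, and `-n` is invertible for negative `n`.
    rw [D_vac, map_zero, zero_sub, ← neg_smul, ← Int.cast_smul_eq_zsmul ℂ] at h
    have hc : ((-(-1 - (k : ℤ)) : ℤ) : ℂ) ≠ 0 := by
      exact_mod_cast (by omega : -(-1 - (k : ℤ)) ≠ 0)
    rw [show (-1 - ((k + 1 : ℕ) : ℤ)) = -1 - k - 1 by push_cast; ring]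
    exact (W.smul_mem_iff hc).1 (h ▸ hD _ ih)

/-- A `D`-stable subspace that is stable under all modes of a generating set is an ideal. -/
theorem isIdeal_of_isGeneratedBy {S : Set V} (hS : IsGeneratedBy S) {W : Submodule ℂ V}
    (hD : ∀ w ∈ W, D w ∈ W) (hW : ∀ u ∈ S, ∀ n, ∀ w ∈ W, nprod n u w ∈ W) : IsIdeal W := by
  let U : Submodule ℂ V :=
    { carrier := {v | ∀ n, ∀ w ∈ W, nprod n v w ∈ W}
      add_mem' := fun {a b} ha hb n w hw => by
        rw [map_add, LinearMap.add_apply]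
        exact W.add_mem (ha n w hw) (hb n w hw)
      zero_mem' := fun n w _ => by simp
      smul_mem' := fun c x hx n w hw => by
        rw [map_smul, LinearMap.smul_apply]
        exact W.smul_mem c (hx n w hw) }
  have hU : U = ⊤ := by
    refine hS U ⟨?_, ?_⟩ fun u hu n w hw => hW u hu n w hw
    · intro n w hw
      rw [nprod_vac_left]
      split_ifs
      exacts [hw, W.zero_mem]
    · intro u hu v hv r q w hw
      rw [nprod_iterate]
      refine finsum_mem_of_forall_mem W fun i => ?_
      exact zsmul_mem (W.sub_mem (hu _ _ (hv _ _ hw)) (zsmul_mem (hv _ _ (hu _ _ hw)) _)) _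
  have hleft : ∀ v : V, ∀ n, ∀ w ∈ W, nprod n v w ∈ W := fun v =>
    (hU ▸ Submodule.mem_top : v ∈ U)
  refine fun v w hw n => ⟨hleft v n w hw, ?_⟩
  -- Write `v = v₋₁ 𝟏` and commute `wₙ` past `v₋₁`: right products reduce to left modes and to
  -- products with `vac`.
  have h := nprod_commutator v w vac (-1) n
  rw [nprod_neg_one_vac, sub_eq_iff_eq_add, ← sub_eq_iff_eq_add'] at h
  rw [← h]
  refine W.sub_mem (hleft _ _ _ (nprod_vac_mem hD hw _)) ?_
  refine finsum_mem_of_forall_mem W fun i => ?_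
  exact zsmul_mem (nprod_vac_mem hD (hleft _ _ _ hw) _) _

/-! ### The degree filtration, idempotents and indecomposability -/

namespace IsNGrading

variable {𝒱 : ℕ → Submodule ℂ V}

theorem nprod_mem_biSup (h : IsNGrading 𝒱) {a b d : ℕ} {n : ℤ} (hd : (d : ℤ) ≤ a + b - n - 1)
    {u v : V} (hu : u ∈ ⨆ k ≥ a, 𝒱 k) (hv : v ∈ ⨆ k ≥ b, 𝒱 k) :
    nprod n u v ∈ ⨆ k ≥ d, 𝒱 k := by
  have key : (⨆ k ≥ a, 𝒱 k) ≤ (⨅ w : (⨆ k ≥ b, 𝒱 k : Submodule ℂ V),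
      (⨆ k ≥ d, 𝒱 k).comap ((nprod n).flip w.1)) := by
    refine iSup₂_le fun k hk x hx => ?_
    rw [Submodule.mem_iInf]
    rintro ⟨w, hw⟩
    have : (⨆ l ≥ b, 𝒱 l) ≤ (⨆ k ≥ d, 𝒱 k).comap (nprod n x) := by
      refine iSup₂_le fun l hl y hy => ?_
      obtain ⟨m, hm⟩ : ∃ m : ℕ, (m : ℤ) = k + l - n - 1 := ⟨(k + l - n - 1).toNat, by omega⟩
      exact Submodule.mem_iSup_of_mem m (Submodule.mem_iSup_of_mem (by omega)
        (h.nprod_mem k l m n hm x hx y hy))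
    exact this hw
  have := key hu
  rw [Submodule.mem_iInf] at this
  exact this ⟨v, hv⟩

theorem vac_mem_biSup (h : IsNGrading 𝒱) : (vac : V) ∈ ⨆ k ≥ 0, 𝒱 k :=
  Submodule.mem_biSup_ge le_rfl h.vac_mem

theorem disjoint_biSup (h : IsNGrading 𝒱) {k d : ℕ} (hk : k < d) :
    Disjoint (𝒱 k) (⨆ l ≥ d, 𝒱 l) :=
  (h.isInternal.submodule_iSupIndep k).mono_right
    (biSup_mono fun l hl => by simpa using (by omega : l ≠ k))

theorem iSup_zero_sup (h : IsNGrading 𝒱) : 𝒱 0 ⊔ ⨆ l ≥ 1, 𝒱 l = ⊤ := by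
  rw [eq_top_iff, ← h.isInternal.submodule_iSup_eq_top]
  refine iSup_le fun k => ?_
  rcases Nat.eq_zero_or_pos k with rfl | hk
  · exact le_sup_left
  · exact fun x hx => Submodule.mem_sup_right (Submodule.mem_biSup_ge hk hx)

theorem D_mem_biSup (h : IsNGrading 𝒱) {d : ℕ} {v : V} (hv : v ∈ ⨆ k ≥ d, 𝒱 k) :
    D v ∈ ⨆ k ≥ d + 1, 𝒱 k :=
  h.nprod_mem_biSup (by push_cast; omega) hv h.vac_mem_biSup

/-- No nonzero vector has components only in arbitrarily high degrees. -/
theorem eq_zero_of_forall_mem_biSup (h : IsNGrading 𝒱) {v : V}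
    (hv : ∀ d : ℕ, v ∈ ⨆ k ≥ d, 𝒱 k) : v = 0 := by
  have htop : v ∈ ⨆ k, 𝒱 k := by simp [h.isInternal.submodule_iSup_eq_top]
  obtain ⟨s, hs⟩ := (Submodule.mem_iSup_iff_exists_finset).1 htop
  obtain ⟨d, hd⟩ := s.bddAbove
  have hdis : Disjoint (⨆ k ∈ s, 𝒱 k) (⨆ k ∈ {k | d + 1 ≤ k}, 𝒱 k) := by
    refine h.isInternal.submodule_iSupIndep.disjoint_biSup_biSup (s := (s : Set ℕ)) ?_
    rw [Set.disjoint_left]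
    intro k hk hk'
    have := hd hk
    simp only [Set.mem_ofPred_eq] at hk'
    omega
  exact Submodule.disjoint_def.1 hdis v hs (hv (d + 1))

/-- The `-1` product adds degrees, so `e = e₋₁ e` pushes `e` into ever higher filtration steps. -/
theorem eq_zero_of_idempotent_of_mem (h : IsNGrading 𝒱) {e : V} (he : nprod (-1) e e = e)
    (he1 : e ∈ ⨆ k ≥ 1, 𝒱 k) : e = 0 := by
  have key : ∀ d : ℕ, e ∈ ⨆ k ≥ d + 1, 𝒱 k := by
    intro d
    induction d with
    | zero => exact he1
    | succ d ih =>
      rw [← he]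
      exact h.nprod_mem_biSup (by push_cast; omega) ih ih
  refine h.eq_zero_of_forall_mem_biSup fun d => ?_
  exact Submodule.biSup_ge_mono 𝒱 d.le_succ (key d)

/-- If `ker D` is spanned by the vacuum in degree zero, the only idempotents in `ker D` are the
trivial ones. -/
theorem idempotent_eq_zero_or_vac (h : IsNGrading 𝒱)
    (hker : LinearMap.ker (D : V →ₗ[ℂ] V) ⊓ 𝒱 0 = Submodule.span ℂ {(vac : V)})
    {e : V} (he : nprod (-1) e e = e)
    (hDe : D e = 0) : e = 0 ∨ e = vac := by
  obtain ⟨a, ha, x, hx, hax⟩ := Submodule.mem_sup.1 (h.iSup_zero_sup ▸ Submodule.mem_top : e ∈ _)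
  -- `D a` has degree one, but equals `-D x`, which lies in degrees at least two.
  have hDa : D a = 0 := by
    have hDa1 : D a ∈ 𝒱 1 := h.nprod_mem 0 0 1 (-2) (by norm_num) a ha vac h.vac_mem
    refine Submodule.disjoint_def.1 (h.disjoint_biSup one_lt_two) _ hDa1 ?_
    rw [← hax, map_add] at hDe
    rw [eq_neg_of_add_eq_zero_left hDe]
    exact Submodule.neg_mem _ (h.D_mem_biSup hx)
  have hspan : a ∈ Submodule.span ℂ {(vac : V)} := hker ▸ ⟨hDa, ha⟩
  obtain ⟨c, rfl⟩ := Submodule.mem_span_singleton.1 hspan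
  by_cases hvac : (vac : V) = 0
  · left
    rw [← nprod_neg_one_vac e, hvac, map_zero]
  -- Otherwise the degree zero part of `e₋₁ e = e` would place `vac` in positive degrees.
  have hc : c * c = c := by
    by_contra hne
    apply hvac
    refine Submodule.disjoint_def.1 (h.disjoint_biSup zero_lt_one) _ h.vac_mem ?_
    rw [← Submodule.smul_mem_iff _ (sub_ne_zero.2 hne)]
    have heq : (c * c - c) • (vac : V) = x - (c + c) • x - nprod (-1) x x := by
      rw [← hax] at he
      simp only [map_add, LinearMap.add_apply, map_smul, LinearMap.smul_apply, nprod_vac_left,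
        if_true, nprod_neg_one_vac] at he
      linear_combination (norm := module) he
    rw [heq]
    exact Submodule.sub_mem _ (Submodule.sub_mem _ hx (Submodule.smul_mem _ _ hx))
      (h.nprod_mem_biSup (by norm_num) hx hx)
  rcases IsIdempotentElem.iff_eq_zero_or_one.1 hc with rfl | rfl
  · left
    refine h.eq_zero_of_idempotent_of_mem he ?_
    rw [← hax]
    simpa using hx
  · right
    -- The complementary idempotent `vac - e` has positive degree.
    refine (sub_eq_zero.1 (h.eq_zero_of_idempotent_of_mem ?_ ?_)).symm
    · simp [nprod_vac_left, nprod_neg_one_vac, he]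
    · rw [← hax, one_smul, sub_add_cancel_left]
      exact Submodule.neg_mem _ hx

/-- Mixed products of the components `e`, `f` of `vac` lie in `I ∩ J = 0`, so `e` is idempotent.
Likewise `D e = -D f` lies in both ideals. An ideal containing `vac` is everything because `x = x₋₁
𝟏`. -/
theorem isIndecomposable [Nontrivial V] (h : IsNGrading 𝒱)
    (hker : LinearMap.ker (D : V →ₗ[ℂ] V) ⊓ 𝒱 0 = Submodule.span ℂ {(vac : V)}) :
    IsIndecomposable V := by
  refine ⟨inferInstance, fun I J hI hJ hIJ => ?_⟩
  have hzero : ∀ x, x ∈ I → x ∈ J → x = 0 := Submodule.disjoint_def.1 hIJ.disjoint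
  obtain ⟨e, he, f, hf, hef⟩ :=
    Submodule.mem_sup.1 (hIJ.sup_eq_top ▸ Submodule.mem_top : (vac : V) ∈ I ⊔ J)
  have hidem : nprod (-1) e e = e := by
    have h1 : nprod (-1) (vac : V) e = e := by simp [nprod_vac_left]
    rw [← hef, map_add, LinearMap.add_apply,
      hzero _ (hI f e he (-1)).1 (hJ e f hf (-1)).2, add_zero] at h1
    exact h1
  have hDe : D e = 0 := by
    refine hzero _ (hI vac e he (-2)).2 ?_
    have : D e + D f = 0 := by rw [← map_add, hef, D_vac]
    rw [eq_neg_of_add_eq_zero_left this]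
    exact J.neg_mem (hJ vac f hf (-2)).2
  rcases h.idempotent_eq_zero_or_vac hker hidem hDe with h0 | h1
  · left
    rw [h0, zero_add] at hef
    refine (Submodule.eq_bot_iff I).2 fun x hx => hzero x hx ?_
    rw [← nprod_neg_one_vac x, ← hef]
    exact (hJ x f hf (-1)).1
  · right
    refine (Submodule.eq_bot_iff J).2 fun x hx => hzero x ?_ hx
    rw [← nprod_neg_one_vac x, ← h1]
    exact (hI x e he (-1)).1

/-! ### The degree zero algebra and the action of degree one -/

/-- Every term of the commutator formula contains `aᵢ b` with `i ≥ 0`, which has negative degree. -/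
theorem nprod_comm_of_degree_zero (h : IsNGrading 𝒱) {a b : V} (ha : a ∈ 𝒱 0) (hb : b ∈ 𝒱 0) :
    nprod (-1) a b = nprod (-1) b a := by
  have := nprod_commutator a b vac (-1) (-1)
  rw [nprod_neg_one_vac, nprod_neg_one_vac, finsum_eq_zero_of_forall_eq_zero] at this
  · exact sub_eq_zero.1 this
  · intro i
    rw [h.nprod_eq_zero 0 0 i (by omega) a ha b hb]
    simp

theorem nprod_assoc_of_degree_zero (h : IsNGrading 𝒱) {a b c : V} (ha : a ∈ 𝒱 0) (hb : b ∈ 𝒱 0)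
    (hc : c ∈ 𝒱 0) : nprod (-1) (nprod (-1) a b) c = nprod (-1) a (nprod (-1) b c) := by
  rw [nprod_iterate, finsum_eq_single _ 0]
  · rw [h.nprod_eq_zero 0 0 (0 : ℕ) (by simp) a ha c hc]
    simp
  · intro i hi
    rw [h.nprod_eq_zero 0 0 (-1 + i) (by omega) b hb c hc,
      h.nprod_eq_zero 0 0 i (by omega) a ha c hc]
    simp

/-- For `p = 0` the commutator formula has a single term, so zero modes are derivations of the `-1`
product. -/
theorem nprod_zero_nprod_neg_one (u a b : V) :
    nprod 0 u (nprod (-1) a b) = nprod (-1) a (nprod 0 u b) + nprod (-1) (nprod 0 u a) b := by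
  have := nprod_commutator u a b 0 (-1)
  rw [finsum_eq_single _ 0] at this
  · rw [sub_eq_iff_eq_add'] at this
    simpa using this
  · intro i hi
    simp [Ring.choose_zero_pos ℤ (Nat.pos_of_ne_zero hi)]

/-- The commutative ring structure `a b = a₋₁ b` on the degree zero subspace. -/
noncomputable abbrev commRingZero (h : IsNGrading 𝒱) : CommRing (𝒱 0) :=
  { (inferInstance : AddCommGroup (𝒱 0)) with
    mul := fun a b => ⟨nprod (-1) a.1 b.1, h.nprod_mem 0 0 0 (-1) (by norm_num) _ a.2 _ b.2⟩
    one := ⟨vac, h.vac_mem⟩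
    left_distrib := fun a b c => Subtype.ext (map_add (nprod (-1) a.1) b.1 c.1)
    right_distrib := fun a b c => Subtype.ext (LinearMap.map_add₂ (nprod (-1)) a.1 b.1 c.1)
    zero_mul := fun a => Subtype.ext (LinearMap.map_zero₂ (nprod (-1)) a.1)
    mul_zero := fun a => Subtype.ext (map_zero (nprod (-1) a.1))
    mul_assoc := fun a b c => Subtype.ext (h.nprod_assoc_of_degree_zero a.2 b.2 c.2)
    one_mul := fun a => Subtype.ext ((nprod_vac_left (-1) a.1).trans (if_pos rfl))
    mul_one := fun a => Subtype.ext (nprod_neg_one_vac a.1)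
    mul_comm := fun a b => Subtype.ext (h.nprod_comm_of_degree_zero a.2 b.2) }

/-- A proper nonzero subspace of degree zero that is stable under all degree-preserving modes of
vectors of degree zero and one. -/
theorem exists_stable_submodule (h : IsNGrading 𝒱) [Module.Finite ℂ (𝒱 0)]
    (hdim : 2 ≤ Module.finrank ℂ (𝒱 0)) :
    ∃ m : Submodule ℂ V, m ≤ 𝒱 0 ∧ m ≠ ⊥ ∧ vac ∉ m ∧
      (∀ a ∈ 𝒱 0, ∀ x ∈ m, nprod (-1) a x ∈ m) ∧ ∀ u ∈ 𝒱 1, ∀ x ∈ m, nprod 0 u x ∈ m := by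
  let := h.commRingZero
  let : Algebra ℂ (𝒱 0) := Algebra.ofModule
    (fun c a b => Subtype.ext (LinearMap.map_smul₂ (nprod (-1)) c a.1 b.1))
    (fun c a b => Subtype.ext (map_smul (nprod (-1) a.1) c b.1))
  obtain ⟨I, hbot, htop, hder⟩ := exists_ideal_stable_derivation (A := 𝒱 0) hdim
  refine ⟨(I.restrictScalars ℂ).map (𝒱 0).subtype, Submodule.map_subtype_le _ _, ?_, ?_, ?_, ?_⟩
  · intro hmap
    refine hbot ((Submodule.eq_bot_iff I).2 fun x hx => Subtype.ext ?_)
    exact (Submodule.eq_bot_iff _).1 hmap x.1 ⟨x, hx, rfl⟩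
  · rintro ⟨x, hx, hxv⟩
    refine htop ((Ideal.eq_top_iff_one I).2 ?_)
    rwa [show (1 : 𝒱 0) = x from Subtype.ext hxv.symm]
  · rintro a ha _ ⟨x, hx, rfl⟩
    exact ⟨(⟨a, ha⟩ : 𝒱 0) * x, I.mul_mem_left _ hx, rfl⟩
  · rintro u hu _ ⟨x, hx, rfl⟩
    let δ : Derivation ℂ (𝒱 0) (𝒱 0) := Derivation.mk'
      ((nprod 0 u).restrict fun b hb => h.nprod_mem 1 0 0 0 (by norm_num) u hu b hb)
      (fun a b => Subtype.ext (by
        have hcomm := h.nprod_comm_of_degree_zero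
          (h.nprod_mem 1 0 0 0 (by norm_num) u hu a.1 a.2) b.2
        have := nprod_zero_nprod_neg_one u a.1 b.1
        rw [hcomm] at this
        exact this))
    exact ⟨δ x, hder δ x hx, rfl⟩

/-! ### The ideal generated by a stable subspace of degree zero -/

/-- The submodules containing `m` and stable under `D` and all modes of vectors of degree at most
one that do not lower the degree. -/
def raisingClosed (𝒱 : ℕ → Submodule ℂ V) (m : Submodule ℂ V) : Set (Submodule ℂ V) :=
  {U | m ≤ U ∧ (∀ x ∈ U, D x ∈ U) ∧
    ∀ k ≤ 1, ∀ u ∈ 𝒱 k, ∀ n : ℤ, n < k → ∀ x ∈ U, nprod n u x ∈ U}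

theorem sInf_raisingClosed_mem (m : Submodule ℂ V) :
    sInf (raisingClosed 𝒱 m) ∈ raisingClosed 𝒱 m := by
  refine ⟨le_sInf fun U hU => hU.1, fun x hx => ?_, fun k hk u hu n hn x hx => ?_⟩
  · rw [Submodule.mem_sInf] at hx ⊢
    exact fun U hU => hU.2.1 x (hx U hU)
  · rw [Submodule.mem_sInf] at hx ⊢
    exact fun U hU => hU.2.2 k hk u hu n hn x (hx U hU)

/-- The closure under the modes that do not lower the degree is closed under all modes. -/
theorem nprod_mem_sInf_raisingClosed (h : IsNGrading 𝒱) {m : Submodule ℂ V} (hm : m ≤ 𝒱 0)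
    {k : ℕ} (hk : k ≤ 1) {u : V} (hu : u ∈ 𝒱 k) (n : ℤ) {x : V}
    (hx : x ∈ sInf (raisingClosed 𝒱 m)) : nprod n u x ∈ sInf (raisingClosed 𝒱 m) := by
  set W := sInf (raisingClosed 𝒱 m) with hWdef
  obtain ⟨hmW, hDW, hrW⟩ : W ∈ raisingClosed 𝒱 m := sInf_raisingClosed_mem m
  -- `U` consists of the vectors of `W` that no mode of degree at most one takes out of `W`. By
  -- minimality of `W` it suffices that `U` is itself raising-closed.
  let U : Submodule ℂ V :=
    { carrier := {x | x ∈ W ∧ ∀ k ≤ 1, ∀ u ∈ 𝒱 k, ∀ n : ℤ, nprod n u x ∈ W}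
      add_mem' := fun {a b} ha hb => ⟨W.add_mem ha.1 hb.1, fun k hk u hu n => by
        rw [map_add]
        exact W.add_mem (ha.2 k hk u hu n) (hb.2 k hk u hu n)⟩
      zero_mem' := ⟨W.zero_mem, fun k hk u hu n => by simp⟩
      smul_mem' := fun c x hx => ⟨W.smul_mem c hx.1, fun k hk u hu n => by
        rw [map_smul]
        exact W.smul_mem c (hx.2 k hk u hu n)⟩ }
  have hU : U ∈ raisingClosed 𝒱 m := by
    refine ⟨fun x hx => ⟨hmW hx, fun k hk u hu n => ?_⟩,
      fun x hx => ⟨hDW x hx.1, fun k hk u hu n => ?_⟩,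
      fun l hl v hv p hp x hx => ⟨hrW l hl v hv p hp x hx.1, fun k hk u hu n => ?_⟩⟩
    · rcases lt_or_ge n k with hn | hn
      · exact hrW k hk u hu n hn x (hmW hx)
      · rw [h.nprod_eq_zero k 0 n (by push_cast; omega) u hu x (hm hx)]
        exact W.zero_mem
    · have := D_nprod n u x
      rw [eq_sub_iff_add_eq] at this
      rw [← this]
      exact W.add_mem (hDW _ (hx.2 k hk u hu n)) (zsmul_mem (hx.2 k hk u hu _) _)
    · have := nprod_commutator u v x n p
      rw [sub_eq_iff_eq_add] at this
      rw [this]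
      refine W.add_mem (finsum_mem_of_forall_mem W fun i => zsmul_mem ?_ _)
        (hrW l hl v hv p hp _ (hx.2 k hk u hu n))
      -- Since `k, l ≤ 1` and `i ≥ 0`, `uᵢ v` vanishes or again has degree at most one, so the
      -- condition defining `U` applies to its modes on `x`.
      rcases lt_or_ge ((k : ℤ) + l - i - 1) 0 with hneg | hnn
      · rw [h.nprod_eq_zero k l i hneg u hu v hv]
        simp
      · obtain ⟨j, hj⟩ := Int.eq_ofNat_of_zero_le hnn
        exact hx.2 j (by omega) _ (h.nprod_mem k l j i hj.symm u hu v hv) _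
  exact ((sInf_le hU : W ≤ U) hx).2 k hk u hu n

/-- The degree zero part of the closure of a stable subspace is that subspace. -/
theorem sInf_raisingClosed_le (h : IsNGrading 𝒱) {m : Submodule ℂ V} (hm : m ≤ 𝒱 0)
    (hm0 : ∀ a ∈ 𝒱 0, ∀ x ∈ m, nprod (-1) a x ∈ m) (hm1 : ∀ u ∈ 𝒱 1, ∀ x ∈ m, nprod 0 u x ∈ m) :
    sInf (raisingClosed 𝒱 m) ≤ m ⊔ ⨆ k ≥ 1, 𝒱 k := by
  refine sInf_le ⟨le_sup_left, fun x hx => ?_, fun k hk u hu n hn x hx => ?_⟩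
  all_goals obtain ⟨y, hy, z, hz, rfl⟩ := Submodule.mem_sup.1 hx
  · refine Submodule.mem_sup_right ?_
    have htop : y + z ∈ ⨆ k ≥ 0, 𝒱 k :=
      Submodule.add_mem _ (Submodule.mem_biSup_ge le_rfl (hm hy))
        (Submodule.biSup_ge_mono 𝒱 (Nat.zero_le 1) hz)
    exact h.D_mem_biSup htop
  · rw [map_add]
    refine Submodule.add_mem _ ?_ (Submodule.mem_sup_right
      (h.nprod_mem_biSup (by push_cast; omega) (Submodule.mem_biSup_ge le_rfl hu) hz))
    -- The mode `n = k - 1` preserves degree and uses the stability of `m`; smaller `n` strictly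
    -- raise degree.
    rcases (Int.le_sub_one_of_lt hn).lt_or_eq with hlt | rfl
    · exact Submodule.mem_sup_right (h.nprod_mem_biSup (b := 0) (by push_cast; omega)
        (Submodule.mem_biSup_ge le_rfl hu) (Submodule.mem_biSup_ge le_rfl (hm hy)))
    · refine Submodule.mem_sup_left ?_
      interval_cases k
      · exact hm0 u hu y hy
      · exact hm1 u hu y hy

/-- The closure of `m` is an ideal containing `m ≠ ⊥`. If it were `⊤`, comparing degree zero parts
would put `vac` in `m`. -/
theorem not_isSimple (h : IsNGrading 𝒱) [Module.Finite ℂ (𝒱 0)]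
    (hdim : 2 ≤ Module.finrank ℂ (𝒱 0))
    (hgen : IsGeneratedBy ((𝒱 0 : Set V) ∪ (𝒱 1 : Set V))) : ¬ IsSimple V := by
  rintro ⟨-, hsimple⟩
  obtain ⟨m, hm, hbot, hvac, hm0, hm1⟩ := h.exists_stable_submodule hdim
  have hmem := sInf_raisingClosed_mem (𝒱 := 𝒱) m
  have hideal : IsIdeal (sInf (raisingClosed 𝒱 m)) := by
    refine isIdeal_of_isGeneratedBy hgen hmem.2.1 ?_
    rintro u (hu | hu) n w hw
    · exact h.nprod_mem_sInf_raisingClosed hm zero_le_one hu n hw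
    · exact h.nprod_mem_sInf_raisingClosed hm le_rfl hu n hw
  rcases hsimple _ hideal with h0 | h1
  · exact hbot (le_bot_iff.1 (h0 ▸ hmem.1))
  · have hv : (vac : V) ∈ m ⊔ ⨆ k ≥ 1, 𝒱 k :=
      h.sInf_raisingClosed_le hm hm0 hm1 (h1 ▸ Submodule.mem_top)
    obtain ⟨y, hy, z, hz, hyz⟩ := Submodule.mem_sup.1 hv
    have hz0 : z = 0 := by
      refine Submodule.disjoint_def.1 (h.disjoint_biSup zero_lt_one) _ ?_ hz
      rw [eq_sub_of_add_eq' hyz]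
      exact Submodule.sub_mem _ h.vac_mem (hm hy)
    rw [hz0, add_zero] at hyz
    exact hvac (hyz ▸ hy)

end IsNGrading

end VertexAlgebra

theorem mainTheorem3 {V : Type*} [AddCommGroup V] [Module ℂ V] [VertexAlgebra V]
    (𝒱 : ℕ → Submodule ℂ V) (h𝒱 : VertexAlgebra.IsNGrading 𝒱)
    (hfin : Module.Finite ℂ (𝒱 0)) (hdim0 : 2 ≤ Module.finrank ℂ (𝒱 0))
    (hgen : VertexAlgebra.IsGeneratedBy ((𝒱 0 : Set V) ∪ (𝒱 1 : Set V)))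
    (hcyc : h𝒱.leibnizOne.IsCyclic)
    (hdim1 : Module.finrank ℂ (𝒱 1) = 2 ∨ Module.finrank ℂ (𝒱 1) = 3)
    (hker : LinearMap.ker (VertexAlgebra.D : V →ₗ[ℂ] V) ⊓ 𝒱 0 =
      Submodule.span ℂ {(VertexAlgebra.vac : V)}) :
    VertexAlgebra.IsIndecomposable V ∧ ¬ VertexAlgebra.IsSimple V := by
  have : Nontrivial (𝒱 0) := Module.nontrivial_of_finrank_pos (R := ℂ) (by omega)
  have : Nontrivial V := (𝒱 0).injective_subtype.nontrivial
  exact ⟨h𝒱.isIndecomposable hker, h𝒱.not_isSimple hdim0 hgen⟩
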